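/- Let $d\ge 0$ be an integer, let $(\mu_k)_{k\in\mathbb Z}$ be a bi-sequence of Borel probability measures on $\mathbb R^d$ and let $\phi$ be an invertible linear map of $\mathbb R^d$. For a Borel probability measure $\rho$ on $\mathbb R^d$ and $k\in\mathbb Z$ write $\phi^k(\rho)$ for the image of $\rho$ under $\phi^k$, and let $*$ denote convolution. A solution is a bi-sequence $(\lambda_k)_{k\in\mathbb Z}$ of Borel probability measures on $\mathbb R^d$ such that $$\lambda_k=\mu_k*\phi(\lambda_{k-1})\qquad\text{for all }k\in\mathbb Z. \tag{1}$$ A solution $(\lambda_k)$ is called fundamental if for each solution $(\nu_k)$ there is a Borel probability measure $\rho$ on $\mathbb R^d$ such that $\nu_k=\lambda_k*\phi^k(\rho)$ for all $k\in\mathbb Z$. The set of solutions is convex (under coordinatewise convex combinations), and its extreme points are called extremal solutions. Then a bi-sequence $(\lambda_k)$ is a fundamental solution of (1) if and only if it is an extremal solution of (1). Moreover, the set $\mathcal E$ of extremal solutions is either empty or in bijection with $\mathbb R^d$: for every $(\lambda_k)\in\mathcal E$, the map $v\mapsto(\lambda_k*\phi^k(\delta_v))_{k\in\mathbb Z}$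 is a bijection from $\mathbb R^d$ onto $\mathcal E$. -/

import Mathlib

open MeasureTheory
open scoped NNReal

/-- The bi-sequence `lam` of probability measures on `ℝ^d` solves the convolution equation
`lam k = mu k * φ (lam (k - 1))` for all `k ∈ ℤ`. -/
def IsSolution {d : ℕ} (mu : ℤ → Measure (EuclideanSpace ℝ (Fin d)))
    (φ : EuclideanSpace ℝ (Fin d) ≃ₗ[ℝ] EuclideanSpace ℝ (Fin d))
    (lam : ℤ → Measure (EuclideanSpace ℝ (Fin d))) : Prop :=
  (∀ k : ℤ, IsProbabilityMeasure (lam k)) ∧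
    ∀ k : ℤ, lam k = Measure.conv (mu k) ((lam (k - 1)).map φ)

/-- The bi-sequence `lam k * φ ^ k (ρ)`, where `φ ^ k` for negative `k` is a power of the
inverse of `φ`. -/
noncomputable def twist {d : ℕ}
    (φ : EuclideanSpace ℝ (Fin d) ≃ₗ[ℝ] EuclideanSpace ℝ (Fin d))
    (lam : ℤ → Measure (EuclideanSpace ℝ (Fin d)))
    (ρ : Measure (EuclideanSpace ℝ (Fin d))) : ℤ → Measure (EuclideanSpace ℝ (Fin d)) :=
  fun k => Measure.conv (lam k) (ρ.map (φ ^ k : EuclideanSpace ℝ (Fin d) ≃ₗ[ℝ] _))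

/-- A solution is fundamental if every solution has the form `lam k * φ ^ k (ρ)` for some
probability measure `ρ` that does not depend on `k`. -/
def IsFundamentalSolution {d : ℕ} (mu : ℤ → Measure (EuclideanSpace ℝ (Fin d)))
    (φ : EuclideanSpace ℝ (Fin d) ≃ₗ[ℝ] EuclideanSpace ℝ (Fin d))
    (lam : ℤ → Measure (EuclideanSpace ℝ (Fin d))) : Prop :=
  IsSolution mu φ lam ∧
    ∀ nu : ℤ → Measure (EuclideanSpace ℝ (Fin d)), IsSolution mu φ nu →
      ∃ ρ : Measure (EuclideanSpace ℝ (Fin d)), IsProbabilityMeasure ρ ∧ nu = twist φ lam ρ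

/-- The set of all solutions. -/
def solutionSet {d : ℕ} (mu : ℤ → Measure (EuclideanSpace ℝ (Fin d)))
    (φ : EuclideanSpace ℝ (Fin d) ≃ₗ[ℝ] EuclideanSpace ℝ (Fin d)) :
    Set (ℤ → Measure (EuclideanSpace ℝ (Fin d))) :=
  {lam | IsSolution mu φ lam}

/-- The extremal solutions: the extreme points of the set of solutions. Bi-sequences of measures
form a cone under coordinatewise operations, so convex combinations are taken with coefficients
in `ℝ≥0`. -/
def extremalSolutions {d : ℕ} (mu : ℤ → Measure (EuclideanSpace ℝ (Fin d)))
    (φ : EuclideanSpace ℝ (Fin d) ≃ₗ[ℝ] EuclideanSpace ℝ (Fin d)) :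
    Set (ℤ → Measure (EuclideanSpace ℝ (Fin d))) :=
  (solutionSet mu φ).extremePoints ℝ≥0

open Filter Topology Pointwise
open scoped ENNReal

/-! ### Tightness through coercive weights, and factors of tight families -/

section Tightness

/-! Pulling the `k`-th measure back by `φ ^ (-k)` turns the equation into `ν k = κ k ∗ ν (k - 1)`,
so `ν k = Q n k ∗ ν (-n)` with `Q n k` the product of the `κ j`, `-n < j ≤ k`. If a solution exists,
a single shift `a n` makes `Q n k ∗ δ_{a n}` tight in `n` for every `k` at once
(`exists_shift_lintegral_le`). Let `L k` be its limit along an ultrafilter. For any solution `ν` the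
cofactors `δ_{-a n} ∗ ν (-n)` are tight too, and their limit `ρ` gives `ν k = L k ∗ ρ`: `L` is
fundamental.

Applied to `L` itself, this forces `charFun ρ = 1`, hence the `charFun (L k)` have no common zero
and `ρ` is determined by `L ∗ ρ`. Solutions thus correspond affinely to probability measures, with
convolution acting on them. Extreme points are the Dirac measures; fundamental solutions correspond
to the convolution-invertible measures, which are again the Dirac measures. -/

lemma isTightMeasureSet_of_lintegral_coercive_le {X : Type*} [TopologicalSpace X]
    [MeasurableSpace X] {V : X → ℝ≥0∞} (hVm : Measurable V)
    (hV : Tendsto V (cocompact X) (𝓝 ⊤)) {S : Set (Measure X)}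
    (hS : ∀ μ ∈ S, ∫⁻ x, V x ∂μ ≤ 1) : IsTightMeasureSet S := by
  rw [isTightMeasureSet_iff_exists_isCompact_measure_compl_le]
  intro ε hε
  obtain ⟨N, hN⟩ := ENNReal.exists_inv_nat_lt hε.ne'
  have hev := ENNReal.tendsto_nhds_top_iff_nnreal.1 hV (N : ℝ≥0)
  obtain ⟨K, hK, hKV⟩ := mem_cocompact.1 hev
  refine ⟨K, hK, fun μ hμ => ?_⟩
  have hN0 : (N : ℝ≥0∞) ≠ 0 := by
    rintro h
    simp [h] at hN
  calc μ Kᶜ ≤ μ {x | (N : ℝ≥0∞) ≤ V x} := by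
        refine measure_mono fun x hx => ?_
        have := hKV hx
        simpa using le_of_lt this
    _ ≤ (∫⁻ x, V x ∂μ) / N :=
        meas_ge_le_lintegral_div hVm.aemeasurable hN0 (ENNReal.natCast_ne_top N)
    _ ≤ 1 / N := by gcongr; exact hS μ hμ
    _ ≤ ε := by rw [one_div]; exact hN.le

variable {E : Type*} [NormedAddCommGroup E] [MeasurableSpace E] [BorelSpace E]
  [SecondCountableTopology E]

/-- Every probability measure integrates some weight that tends to infinity at infinity. -/
lemma exists_coercive_weight [CompleteSpace E] (μ : Measure E) [IsProbabilityMeasure μ] :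
    ∃ V : E → ℝ≥0∞, Measurable V ∧ Tendsto V (cocompact E) (𝓝 ⊤) ∧ ∫⁻ x, V x ∂μ ≤ 1 := by
  obtain ⟨ε, hε, hsum⟩ := ENNReal.exists_pos_sum_of_countable' one_ne_zero ℕ
  have ht : IsTightMeasureSet {μ} := isTightMeasureSet_singleton
  rw [isTightMeasureSet_iff_exists_isCompact_measure_compl_le] at ht
  choose K hK hμK using fun j => ht (ε j) (hε j)
  -- The weight counts the compacts `K j` that miss `x`; it is at least `N` off the union of the
  -- first `N`.
  refine ⟨fun x => ∑' j, (K j)ᶜ.indicator 1 x, ?_, ?_, ?_⟩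
  · exact Measurable.tsum fun j =>
      measurable_one.indicator (hK j).isClosed.measurableSet.compl
  · rw [ENNReal.tendsto_nhds_top_iff_nnreal]
    intro c
    obtain ⟨N, hN⟩ := exists_nat_gt c
    have hcpt : IsCompact (⋃ j ∈ Finset.range N, K j) :=
      (Finset.range N).isCompact_biUnion fun j _ => hK j
    filter_upwards [hcpt.compl_mem_cocompact] with x hx
    have hx' : ∀ j ∈ Finset.range N, (K j)ᶜ.indicator (1 : E → ℝ≥0∞) x = 1 := by
      intro j hj
      have hxj : x ∈ (K j)ᶜ := fun h => hx (Set.mem_biUnion hj h)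
      simp [hxj]
    calc (c : ℝ≥0∞) < N := by exact_mod_cast hN
      _ = ∑ j ∈ Finset.range N, (K j)ᶜ.indicator (1 : E → ℝ≥0∞) x := by
        rw [Finset.sum_congr rfl hx']; simp
      _ ≤ _ := ENNReal.sum_le_tsum _
  · rw [lintegral_tsum fun j =>
      (measurable_one.indicator (hK j).isClosed.measurableSet.compl).aemeasurable]
    refine le_trans (ENNReal.tsum_le_tsum fun j => ?_) hsum.le
    rw [lintegral_indicator_one (hK j).isClosed.measurableSet.compl]
    exact hμK j μ rfl

/-- A countable family of probability measures admits coercive weights whose integrals have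
total mass at most one. -/
lemma exists_coercive_weights [CompleteSpace E] {ι : Type*} [Countable ι] (μ : ι → Measure E)
    [∀ i, IsProbabilityMeasure (μ i)] :
    ∃ V : ι → E → ℝ≥0∞, (∀ i, Measurable (V i)) ∧
      (∀ i, Tendsto (V i) (cocompact E) (𝓝 ⊤)) ∧ ∑' i, ∫⁻ x, V i x ∂μ i ≤ 1 := by
  choose V hVm hVt hVi using fun i => exists_coercive_weight (μ i)
  obtain ⟨ε, hε, hsum⟩ := ENNReal.exists_pos_sum_of_countable one_ne_zero ι
  refine ⟨fun i x => ε i * V i x, fun i => (hVm i).const_mul _, fun i => ?_, ?_⟩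
  · have h := ENNReal.Tendsto.const_mul (a := (ε i : ℝ≥0∞)) (hVt i) (Or.inl ENNReal.top_ne_zero)
    rwa [ENNReal.mul_top (by simpa using (hε i).ne')] at h
  · refine le_trans (ENNReal.tsum_le_tsum fun i => ?_) hsum.le
    rw [lintegral_const_mul _ (hVm i)]
    exact mul_le_of_le_one_right' (hVi i)

/-- If the measures `Q i` are left factors, with a common right factor, of measures `μ i` which
integrate the weights `V i`, then a common translate of the `Q i` integrates these weights. -/
lemma exists_shift_lintegral_le {ι : Type*} [Countable ι] {μ Q : ι → Measure E} (σ : Measure E)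
    [IsProbabilityMeasure σ] [∀ i, IsProbabilityMeasure (Q i)] {s : Set ι}
    (hμ : ∀ i ∈ s, μ i = Q i ∗ σ) {V : ι → E → ℝ≥0∞} (hVm : ∀ i, Measurable (V i))
    (hV : ∑' i, ∫⁻ x, V i x ∂μ i ≤ 1) :
    ∃ a : E, ∀ i ∈ s, ∫⁻ x, V i x ∂(Q i ∗ Measure.dirac a) ≤ 1 := by
  have hm : ∀ i : s, Measurable fun y => ∫⁻ x, V i (y + x) ∂Q i := fun i =>
    Measurable.lintegral_prod_right' (f := fun p : E × E => V i (p.1 + p.2))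
      ((hVm i).comp measurable_add)
  -- The summed integral, averaged over shifts with law `σ`, is at most one, so some single shift
  -- does no worse than the average.
  obtain ⟨a, ha⟩ := exists_le_lintegral (μ := σ)
    (f := fun y => ∑' i : s, ∫⁻ x, V i (y + x) ∂Q i)
    (Measurable.tsum hm).aemeasurable
  have hle : ∫⁻ y, ∑' i : s, ∫⁻ x, V i (y + x) ∂Q i ∂σ ≤ 1 := by
    rw [lintegral_tsum fun i => (hm i).aemeasurable]
    have h1 : ∀ i : s, ∫⁻ y, ∫⁻ x, V i (y + x) ∂Q i ∂σ = ∫⁻ x, V i x ∂μ i := fun i => by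
      rw [hμ i i.2, Measure.conv_comm, Measure.lintegral_conv (hVm i)]
    simp_rw [h1]
    exact (ENNReal.tsum_comp_le_tsum_of_injective Subtype.val_injective
      (fun i => ∫⁻ x, V i x ∂μ i)).trans hV
  refine ⟨a, fun i hi => ?_⟩
  rw [Measure.conv_comm, Measure.lintegral_conv (hVm i), lintegral_dirac' a (hm ⟨i, hi⟩)]
  exact (ENNReal.le_tsum (f := fun i : s => ∫⁻ x, V i (a + x) ∂Q i) ⟨i, hi⟩).trans (ha.trans hle)

/-- If `x + y ∈ K'` and `x ∈ K`, then `y` lies in the compact set `K' - K`. -/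
lemma isTightMeasureSet_right_factor {ι : Type*} {α β : ι → Measure E}
    [∀ i, IsProbabilityMeasure (α i)] [∀ i, IsProbabilityMeasure (β i)]
    (hα : IsTightMeasureSet (Set.range α))
    (hαβ : IsTightMeasureSet (Set.range fun i => α i ∗ β i)) :
    IsTightMeasureSet (Set.range β) := by
  rw [isTightMeasureSet_iff_exists_isCompact_measure_compl_le] at *
  intro ε hε
  have hε2 : 0 < ε / 2 := ENNReal.half_pos hε.ne'
  obtain ⟨K, hK, hKα⟩ := hα _ hε2
  obtain ⟨K', hK', hKαβ⟩ := hαβ _ hε2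
  have hKK : IsCompact (K' - K) := by
    rw [← Set.sub_image_prod]
    exact (hK'.prod hK).image continuous_sub
  refine ⟨K' - K, hKK, ?_⟩
  rintro _ ⟨i, rfl⟩
  have hKm := hK.isClosed.measurableSet
  have hKm' := hK'.isClosed.measurableSet
  calc β i (K' - K)ᶜ = (α i).prod (β i) (Prod.snd ⁻¹' (K' - K)ᶜ) := by
        rw [← Set.univ_prod, Measure.prod_prod]; simp
    _ ≤ (α i).prod (β i) (((fun p : E × E => p.1 + p.2) ⁻¹' K'ᶜ) ∪ Prod.fst ⁻¹' Kᶜ) := by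
        refine measure_mono fun p hp => ?_
        by_contra h
        simp only [Set.mem_union, Set.mem_preimage, Set.mem_compl_iff, not_or, not_not] at h
        exact hp (Set.mem_sub.2 ⟨p.1 + p.2, h.1, p.1, h.2, by abel⟩)
    _ ≤ _ := measure_union_le _ _
    _ = (α i ∗ β i) K'ᶜ + α i Kᶜ := by
        rw [Measure.conv, Measure.map_apply measurable_add hKm'.compl, ← Set.prod_univ,
          Measure.prod_prod]
        simp
    _ ≤ ε / 2 + ε / 2 := add_le_add (hKαβ _ ⟨i, rfl⟩) (hKα _ ⟨i, rfl⟩)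
    _ = ε := ENNReal.add_halves ε

end Tightness

/-! ### Ultrafilter limits and characteristic functions equal to one -/

section CharFun

variable {E : Type*} [NormedAddCommGroup E] [InnerProductSpace ℝ E] [MeasurableSpace E]
  [BorelSpace E]

/-- Prokhorov's theorem; an ultrafilter avoids extracting subsequences for each `k`. -/
lemma exists_tendsto_charFun_of_isTightMeasureSet {ι : Type*} (U : Ultrafilter ι)
    {S : Set (Measure E)} (hS : IsTightMeasureSet S) (μ : ι → Measure E)
    [∀ i, IsProbabilityMeasure (μ i)] (hμ : ∀ᶠ i in U, μ i ∈ S) :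
    ∃ L : Measure E, IsProbabilityMeasure L ∧
      ∀ t, Tendsto (fun i => charFun (μ i) t) U (𝓝 (charFun L t)) := by
  let T : Set (ProbabilityMeasure E) := {P | (P : Measure E) ∈ S}
  have hT : IsCompact (closure T) := isCompact_closure_of_isTightMeasureSet
    (hS.subset (by rintro _ ⟨P, hP, rfl⟩; exact hP))
  let P : ι → ProbabilityMeasure E := fun i => ⟨μ i, inferInstance⟩
  obtain ⟨L, -, hL⟩ := hT.ultrafilter_le_nhds (U.map P) (by
    rw [le_principal_iff]
    show ∀ᶠ i in U, P i ∈ closure T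
    filter_upwards [hμ] with i hi
    exact subset_closure hi)
  refine ⟨L, inferInstance, fun t => ?_⟩
  have hL' : Tendsto P U (𝓝 L) := hL
  rw [ProbabilityMeasure.tendsto_iff_forall_integral_rclike_tendsto ℂ] at hL'
  simp_rw [charFun_eq_integral_innerProbChar]
  exact hL' (BoundedContinuousFunction.innerProbChar t)

variable [SecondCountableTopology E]

/-- An average of points of the unit circle equals `1` only if almost all of them do. -/
lemma charFun_eq_one_iff {μ : Measure E} [IsProbabilityMeasure μ] {t : E} :
    charFun μ t = 1 ↔ ∀ᵐ x ∂μ, Complex.exp (inner ℝ x t * Complex.I) = 1 := by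
  constructor
  · intro h
    rw [charFun_apply] at h
    have hi : Integrable (fun x => Complex.exp (inner ℝ x t * Complex.I)) μ :=
      (integrable_const (1 : ℝ)).mono (by fun_prop) (by simp [Complex.norm_exp_ofReal_mul_I])
    have hre : ∫ x, (Complex.exp (inner ℝ x t * Complex.I)).re ∂μ = 1 := by
      have := integral_re hi
      simpa [h] using this
    have h0 : ∫ x, (1 - (Complex.exp (inner ℝ x t * Complex.I)).re) ∂μ = 0 := by
      exact (integral_sub (integrable_const _) hi.re).trans (by simpa [sub_eq_zero] using hre.symm)
    have hle : ∀ x, (Complex.exp (inner ℝ x t * Complex.I)).re ≤ 1 := fun x =>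
      (Complex.re_le_norm _).trans (Complex.norm_exp_ofReal_mul_I _).le
    rw [integral_eq_zero_iff_of_nonneg (fun x => sub_nonneg.2 (hle x))
      ((integrable_const _).sub hi.re)] at h0
    filter_upwards [h0] with x hx
    have hx' : Real.cos (inner ℝ x t) = 1 := by
      rw [← Complex.exp_ofReal_mul_I_re]
      exact (sub_eq_zero.1 hx).symm
    have hs : Real.sin (inner ℝ x t) = 0 := by
      have := Real.sin_sq_add_cos_sq (inner ℝ x t)
      rw [hx'] at this
      nlinarith
    apply Complex.ext
    · rw [Complex.exp_ofReal_mul_I_re, hx']; simp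
    · rw [Complex.exp_ofReal_mul_I_im, hs]; simp
  · intro h
    rw [charFun_apply, integral_congr_ae h]
    simp

lemma charFun_nsmul_eq_one {μ : Measure E} [IsProbabilityMeasure μ] {t : E}
    (h : charFun μ t = 1) (n : ℕ) : charFun μ (n • t) = 1 := by
  rw [charFun_eq_one_iff] at *
  filter_upwards [h] with x hx
  rw [← Nat.cast_smul_eq_nsmul ℝ, inner_smul_right]
  push_cast
  rw [mul_assoc, Complex.exp_nat_mul, hx, one_pow]

/-- A factor of a probability measure that does not change it has characteristic function one. -/
lemma charFun_eq_one_of_conv_eq_self {μ ρ : Measure E} [IsProbabilityMeasure μ]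
    [IsProbabilityMeasure ρ] (h : μ ∗ ρ = μ) (t : E) : charFun ρ t = 1 := by
  have hc : Continuous (charFun μ) := by fun_prop
  have h0 : charFun μ 0 ≠ 0 := by simp
  -- Near `0` `charFun μ` can be cancelled, so `charFun ρ` is one at `t / (n + 1)` for some `n`,
  -- hence at its multiple `t`.
  have hlim : Tendsto (fun n : ℕ => ((n : ℝ) + 1)⁻¹ • t) atTop (𝓝 0) := by
    have := (tendsto_one_div_add_atTop_nhds_zero_nat (𝕜 := ℝ)).smul_const t
    simpa using this
  obtain ⟨n, hn⟩ := (hlim.eventually (hc.continuousAt.eventually_ne h0)).exists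
  have h1 : charFun ρ (((n : ℝ) + 1)⁻¹ • t) = 1 := by
    have := charFun_conv (μ := μ) (ν := ρ) (((n : ℝ) + 1)⁻¹ • t)
    rw [h] at this
    exact mul_left_cancel₀ hn (by rw [mul_one]; exact this.symm)
  have h2 := charFun_nsmul_eq_one h1 (n + 1)
  rw [← Nat.cast_smul_eq_nsmul ℝ, smul_smul] at h2
  push_cast at h2
  rwa [mul_inv_cancel₀ (by positivity), one_smul] at h2

end CharFun

/-! ### Finite convolution products -/

section PartialConv

variable {E : Type*} [NormedAddCommGroup E] [MeasurableSpace E] [BorelSpace E]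
  [SecondCountableTopology E]

/-- The convolution `κ (m + n) ∗ ⋯ ∗ κ (m + 1)`. -/
noncomputable def partialConv {E : Type*} [NormedAddCommGroup E] [MeasurableSpace E]
    (κ : ℤ → Measure E) (m : ℤ) : ℕ → Measure E
  | 0 => Measure.dirac 0
  | n + 1 => κ (m + (n + 1 : ℕ)) ∗ partialConv κ m n

instance isProbabilityMeasure_partialConv (κ : ℤ → Measure E) [∀ k, IsProbabilityMeasure (κ k)]
    (m : ℤ) (n : ℕ) : IsProbabilityMeasure (partialConv κ m n) := by
  induction n with
  | zero => unfold partialConv; infer_instance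
  | succ n ih => unfold partialConv; infer_instance

lemma eq_partialConv_conv {κ ν : ℤ → Measure E} [∀ k, IsProbabilityMeasure (κ k)]
    [∀ k, IsProbabilityMeasure (ν k)] (hν : ∀ k, ν k = κ k ∗ ν (k - 1)) (m : ℤ) (n : ℕ) :
    ν (m + n) = partialConv κ m n ∗ ν m := by
  induction n with
  | zero => simp [partialConv]
  | succ n ih =>
    rw [hν, partialConv, Measure.conv_assoc, ← ih]
    congr 2
    push_cast
    ring

end PartialConv

/-! ### Construction of a fundamental solution when `φ` is the identity -/

section Fundamental

variable {E : Type*} [NormedAddCommGroup E] [InnerProductSpace ℝ E] [MeasurableSpace E]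
  [BorelSpace E] [SecondCountableTopology E] [CompleteSpace E]

/-- If the equation `λ k = κ k ∗ λ (k - 1)` has a solution, then it has a solution `L` of which
every solution is a translate by a fixed probability measure, and such that the characteristic
functions of the `L k` have no common zero. -/
theorem exists_fundamental_of_isSolution (κ lam : ℤ → Measure E)
    [∀ k, IsProbabilityMeasure (κ k)] [∀ k, IsProbabilityMeasure (lam k)]
    (hlam : ∀ k, lam k = κ k ∗ lam (k - 1)) :
    ∃ L : ℤ → Measure E, (∀ k, IsProbabilityMeasure (L k)) ∧ (∀ k, L k = κ k ∗ L (k - 1)) ∧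
      (∀ ν : ℤ → Measure E, (∀ k, IsProbabilityMeasure (ν k)) → (∀ k, ν k = κ k ∗ ν (k - 1)) →
        ∃ ρ : Measure E, IsProbabilityMeasure ρ ∧ ∀ k, ν k = L k ∗ ρ) ∧
      ∀ t, ∃ k, charFun (L k) t ≠ 0 := by
  obtain ⟨V, hVm, hVt, hV⟩ := exists_coercive_weights lam
  -- For `k < -n`, `toNat` truncates to `0` and the value `δ_0` is meaningless; each fixed `k` meets
  -- this for finitely many `n` only.
  let Q : ℕ → ℤ → Measure E := fun n k => partialConv κ (-n) (k + n).toNat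
  have hQ : ∀ ν : ℤ → Measure E, (∀ k, IsProbabilityMeasure (ν k)) →
      (∀ k, ν k = κ k ∗ ν (k - 1)) → ∀ (n : ℕ) (k : ℤ), -n ≤ k → ν k = Q n k ∗ ν (-n) := by
    intro ν hνp hν n k hk
    have := eq_partialConv_conv hν (-n) (k + n).toNat
    rwa [Int.toNat_of_nonneg (by omega), show (-n + (k + n) : ℤ) = k by ring] at this
  have hQstep : ∀ (n : ℕ) (k : ℤ), -n < k → Q n k = κ k ∗ Q n (k - 1) := by
    intro n k hk
    obtain ⟨j, hj⟩ := Int.eq_ofNat_of_zero_le (show 0 ≤ k - 1 + n by omega)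
    obtain rfl : k = -n + (j + 1 : ℕ) := by push_cast; omega
    have h1 : ((-n + (j + 1 : ℕ) : ℤ) + n).toNat = j + 1 := by omega
    have h2 : ((-n + (j + 1 : ℕ) : ℤ) - 1 + n).toNat = j := by omega
    simp only [Q, h1, h2, partialConv]
  have hQp : ∀ n k, IsProbabilityMeasure (Q n k) := fun n k =>
    isProbabilityMeasure_partialConv κ _ _
  choose a ha using fun n : ℕ => exists_shift_lintegral_le (Q := Q n) (lam (-n))
    (s := {k | -(n : ℤ) ≤ k}) (fun k hk => hQ lam inferInstance hlam n k hk) hVm hV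
  let U : Ultrafilter ℕ := hyperfilter ℕ
  have hUle : (U : Filter ℕ) ≤ atTop := Nat.hyperfilter_le_atTop
  have hUge : ∀ k : ℤ, ∀ᶠ n : ℕ in U, -(n : ℤ) < k := fun k =>
    hUle (by filter_upwards [eventually_gt_atTop (-k).toNat] with n hn; omega)
  have htight : ∀ k, IsTightMeasureSet {μ : Measure E | ∫⁻ x, V k x ∂μ ≤ 1} := fun k =>
    isTightMeasureSet_of_lintegral_coercive_le (hVm k) (hVt k) fun μ hμ => hμ
  choose L hLp hL using fun k => exists_tendsto_charFun_of_isTightMeasureSet U (htight k)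
    (fun n => Q n k ∗ Measure.dirac (a n))
    (by filter_upwards [hUge k] with n hn using ha n k hn.le)
  have hLsol : ∀ k, L k = κ k ∗ L (k - 1) := by
    intro k
    refine Measure.ext_of_charFun (funext fun t => ?_)
    rw [charFun_conv]
    refine tendsto_nhds_unique (hL k t) (((hL (k - 1) t).const_mul (charFun (κ k) t)).congr' ?_)
    filter_upwards [hUge k] with n hn
    rw [hQstep n k hn, Measure.conv_assoc, charFun_conv, charFun_conv, charFun_conv]
  have key : ∀ ν : ℤ → Measure E, (∀ k, IsProbabilityMeasure (ν k)) →
      (∀ k, ν k = κ k ∗ ν (k - 1)) → ∃ ρ : Measure E, IsProbabilityMeasure ρ ∧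
        (∀ k, ν k = L k ∗ ρ) ∧ ∀ t, Tendsto
          (fun n : ℕ => charFun (Measure.dirac (-a n) ∗ ν (-n)) t) U (𝓝 (charFun ρ t)) := by
    intro ν hνp hν
    have hfac : ∀ (n : ℕ) (k : ℤ), -n ≤ k →
        (Q n k ∗ Measure.dirac (a n)) ∗ (Measure.dirac (-a n) ∗ ν (-n)) = ν k := by
      intro n k hk
      rw [Measure.conv_assoc, ← Measure.conv_assoc (Measure.dirac (a n)),
        Measure.dirac_conv_dirac, add_neg_cancel, Measure.dirac_zero_conv, ← hQ ν hνp hν n k hk]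
    have ht : IsTightMeasureSet (Set.range fun n : ℕ => Measure.dirac (-a n) ∗ ν (-n)) := by
      -- The cofactor does not depend on `k`, so index `0`, admissible for every `n`, suffices.
      refine isTightMeasureSet_right_factor (α := fun n => Q n 0 ∗ Measure.dirac (a n)) ?_ ?_
      · refine (htight 0).subset ?_
        rintro _ ⟨n, rfl⟩
        exact ha n 0 (by simp)
      · refine (isTightMeasureSet_singleton (μ := ν 0)).subset ?_
        rintro _ ⟨n, rfl⟩
        exact hfac n 0 (by simp)
    obtain ⟨ρ, hρp, hρ⟩ := exists_tendsto_charFun_of_isTightMeasureSet U ht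
      (fun n : ℕ => Measure.dirac (-a n) ∗ ν (-n)) (Eventually.of_forall fun n => ⟨n, rfl⟩)
    refine ⟨ρ, hρp, fun k => ?_, hρ⟩
    refine Measure.ext_of_charFun (funext fun t => ?_)
    rw [charFun_conv]
    refine tendsto_nhds_unique (tendsto_const_nhds.congr' ?_) ((hL k t).mul (hρ t))
    filter_upwards [hUge k] with n hn
    rw [← charFun_conv, hfac n k hn.le]
  refine ⟨L, hLp, hLsol, fun ν hνp hν => ?_, fun t => ?_⟩
  · obtain ⟨ρ, hρp, hρ, -⟩ := key ν hνp hν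
    exact ⟨ρ, hρp, hρ⟩
  -- Since `L 0 = L 0 ∗ ρ`, the cofactors of `L` have characteristic functions tending to `1`, so
  -- `charFun (L (-n)) t` is nonzero for some `n`.
  · obtain ⟨ρ, hρp, hρ, hlim⟩ := key L hLp hLsol
    have h1 : charFun ρ t = 1 := charFun_eq_one_of_conv_eq_self (hρ 0).symm t
    obtain ⟨n, hn⟩ := ((hlim t).eventually_ne (h1 ▸ one_ne_zero)).exists
    refine ⟨-n, fun h => hn ?_⟩
    rw [charFun_conv, h, mul_zero]

end Fundamental

/-! ### Dirac measures as extreme points and as convolution units -/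

section Dirac

variable {E : Type*} [MeasurableSpace E]

lemma eq_dirac_of_ae_eq {ρ : Measure E} [IsProbabilityMeasure ρ] {v : E}
    (h : ∀ᵐ x ∂ρ, x = v) : ρ = Measure.dirac v := by
  have h1 : ρ.map id = ρ.map fun _ => v := Measure.map_congr h
  simpa [Measure.map_const] using h1

lemma isProbabilityMeasure_smul_add_smul {ρ₁ ρ₂ : Measure E} [IsProbabilityMeasure ρ₁]
    [IsProbabilityMeasure ρ₂] {s t : ℝ≥0} (hst : s + t = 1) :
    IsProbabilityMeasure (s • ρ₁ + t • ρ₂) := ⟨by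
  rw [Measure.add_apply, Measure.coe_nnreal_smul_apply, Measure.coe_nnreal_smul_apply,
    measure_univ, measure_univ, mul_one, mul_one]
  exact_mod_cast hst⟩

lemma eq_dirac_of_smul_add_smul_eq_dirac [MeasurableSingletonClass E] {ρ₁ ρ₂ : Measure E}
    [IsProbabilityMeasure ρ₁] {s t : ℝ≥0} (hs : 0 < s) {v : E}
    (h : s • ρ₁ + t • ρ₂ = Measure.dirac v) : ρ₁ = Measure.dirac v := by
  refine eq_dirac_of_ae_eq ?_
  have h0 : (s • ρ₁ + t • ρ₂) {v}ᶜ = 0 := by rw [h]; simp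
  rw [Measure.add_apply, add_eq_zero, Measure.coe_nnreal_smul_apply] at h0
  exact (mul_eq_zero.1 h0.1).resolve_left (by simpa using hs.ne')

/-- Independent variables with sum zero are constant: fix a typical value of one of them. -/
lemma exists_eq_dirac_of_conv_eq_dirac_zero {E : Type*} [AddCommGroup E] [MeasurableSpace E]
    [MeasurableAdd₂ E] [MeasurableSingletonClass E] {ρ σ : Measure E} [IsProbabilityMeasure ρ]
    [IsProbabilityMeasure σ] (h : ρ ∗ σ = Measure.dirac 0) : ∃ v, ρ = Measure.dirac v := by
  rw [Measure.conv_comm] at h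
  have h0 : ∀ᵐ z ∂(σ ∗ ρ), z = 0 := by
    simp [h, ae_dirac_eq]
  have h1 : ∀ᵐ p ∂σ.prod ρ, p.1 + p.2 = 0 := by
    rw [Measure.conv] at h0
    exact ae_of_ae_map (by fun_prop) h0
  obtain ⟨x, hx⟩ := (Measure.ae_ae_of_ae_prod h1).exists
  refine ⟨-x, eq_dirac_of_ae_eq ?_⟩
  filter_upwards [hx] with y hy
  exact eq_neg_of_add_eq_zero_right hy

/-- A probability measure that is not a Dirac measure is a nontrivial convex combination. -/
lemma exists_convex_combination_of_not_dirac [StandardBorelSpace E] {ρ : Measure E}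
    [IsProbabilityMeasure ρ] (h : ∀ v, ρ ≠ Measure.dirac v) :
    ∃ (ρ₁ ρ₂ : Measure E) (s t : ℝ≥0), IsProbabilityMeasure ρ₁ ∧ IsProbabilityMeasure ρ₂ ∧
      0 < s ∧ 0 < t ∧ s + t = 1 ∧ s • ρ₁ + t • ρ₂ = ρ ∧ ρ₁ ≠ ρ := by
  have hz : ¬ IsZeroOneMeasure ρ := by
    intro hz
    obtain ⟨v, hv⟩ := IsZeroOneMeasure.exists_eq_dirac (μ := ρ)
    exact h v hv
  obtain ⟨A, hA, hA0, hA1⟩ : ∃ A, MeasurableSet A ∧ ρ A ≠ 0 ∧ ρ A ≠ 1 := by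
    by_contra! hc
    exact hz ⟨fun A hA => or_iff_not_imp_left.2 (hc A hA)⟩
  have hAc : ρ Aᶜ ≠ 0 := fun h0 => hA1 ((prob_compl_eq_zero_iff hA).1 h0)
  have hcond : ∀ B : Set E, ρ B ≠ 0 →
      (ρ B).toNNReal • ProbabilityTheory.cond ρ B = ρ.restrict B := by
    intro B hB
    rw [ProbabilityTheory.cond, ← Measure.coe_nnreal_smul,
      ENNReal.coe_toNNReal (measure_ne_top ρ B), smul_smul,
      ENNReal.mul_inv_cancel hB (measure_ne_top ρ B), one_smul]
  -- Condition on `A` and on its complement; the first gives `A` mass one, while `ρ` does not.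
  refine ⟨ProbabilityTheory.cond ρ A, ProbabilityTheory.cond ρ Aᶜ, (ρ A).toNNReal,
    (ρ Aᶜ).toNNReal, ProbabilityTheory.cond_isProbabilityMeasure hA0,
    ProbabilityTheory.cond_isProbabilityMeasure hAc,
    ENNReal.toNNReal_pos hA0 (measure_ne_top _ _), ENNReal.toNNReal_pos hAc (measure_ne_top _ _),
    ?_, ?_, ?_⟩
  · rw [← ENNReal.toNNReal_add (measure_ne_top _ _) (measure_ne_top _ _),
      prob_add_prob_compl hA, ENNReal.toNNReal_one]
  · rw [hcond A hA0, hcond Aᶜ hAc, Measure.restrict_add_restrict_compl hA]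
  · intro he
    have := ProbabilityTheory.cond_apply_self hA0 (measure_ne_top ρ A)
    rw [he] at this
    exact hA1 this

end Dirac

/-! ### Transfer to general `φ`, and the two kinds of solutions -/

section Twist

variable {d : ℕ} {mu lam : ℤ → Measure (EuclideanSpace ℝ (Fin d))}
  {φ : EuclideanSpace ℝ (Fin d) ≃ₗ[ℝ] EuclideanSpace ℝ (Fin d)}
  {ρ σ : Measure (EuclideanSpace ℝ (Fin d))}

lemma measurable_linearEquiv (ψ : EuclideanSpace ℝ (Fin d) ≃ₗ[ℝ] EuclideanSpace ℝ (Fin d)) :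
    Measurable ψ :=
  (LinearMap.continuous_of_finiteDimensional ψ.toLinearMap).measurable

lemma map_conv_linearEquiv [SFinite ρ] [SFinite σ]
    (ψ : EuclideanSpace ℝ (Fin d) ≃ₗ[ℝ] EuclideanSpace ℝ (Fin d)) :
    (ρ ∗ σ).map ψ = ρ.map ψ ∗ σ.map ψ :=
  Measure.map_conv_continuousLinearMap (LinearMap.toContinuousLinearMap ψ.toLinearMap)

lemma map_zpow_map_zpow (j k : ℤ) : (ρ.map ⇑(φ ^ j)).map ⇑(φ ^ k) = ρ.map ⇑(φ ^ (k + j)) := by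
  rw [Measure.map_map (measurable_linearEquiv _) (measurable_linearEquiv _), zpow_add]
  rfl

lemma map_zpow_map (k : ℤ) : (ρ.map φ).map ⇑(φ ^ k) = ρ.map ⇑(φ ^ (k + 1)) := by
  simpa using map_zpow_map_zpow (φ := φ) (ρ := ρ) 1 k

lemma map_map_zpow (k : ℤ) : (ρ.map ⇑(φ ^ k)).map φ = ρ.map ⇑(φ ^ (1 + k)) := by
  simpa using map_zpow_map_zpow (φ := φ) (ρ := ρ) k 1

lemma map_zpow_zero : ρ.map ⇑(φ ^ (0 : ℤ)) = ρ := by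
  rw [zpow_zero]
  exact Measure.map_id

instance isProbabilityMeasure_map_linearEquiv [IsProbabilityMeasure ρ]
    (ψ : EuclideanSpace ℝ (Fin d) ≃ₗ[ℝ] EuclideanSpace ℝ (Fin d)) :
    IsProbabilityMeasure (ρ.map ψ) :=
  Measure.isProbabilityMeasure_map (measurable_linearEquiv ψ).aemeasurable

lemma IsSolution.twist [∀ k, IsProbabilityMeasure (mu k)] (h : IsSolution mu φ lam)
    [IsProbabilityMeasure ρ] : IsSolution mu φ (twist φ lam ρ) := by
  have := h.1
  refine ⟨fun k => by unfold _root_.twist; infer_instance, fun k => ?_⟩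
  simp only [_root_.twist]
  rw [map_conv_linearEquiv, map_map_zpow, add_sub_cancel, ← Measure.conv_assoc, ← h.2 k]

lemma twist_twist [∀ k, IsProbabilityMeasure (lam k)] [IsProbabilityMeasure ρ]
    [IsProbabilityMeasure σ] : twist φ (twist φ lam ρ) σ = twist φ lam (ρ ∗ σ) := by
  funext k
  simp only [twist]
  rw [map_conv_linearEquiv, Measure.conv_assoc]

lemma twist_dirac_zero [∀ k, IsProbabilityMeasure (lam k)] :
    twist φ lam (Measure.dirac 0) = lam := by
  funext k
  simp only [twist]
  rw [Measure.map_dirac' (measurable_linearEquiv _), map_zero, Measure.conv_dirac_zero]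

lemma conv_map_smul_add_smul {μ : Measure (EuclideanSpace ℝ (Fin d))} [SFinite μ] [SFinite ρ]
    [SFinite σ] (ψ : EuclideanSpace ℝ (Fin d) ≃ₗ[ℝ] EuclideanSpace ℝ (Fin d)) (s t : ℝ≥0) :
    μ ∗ (s • ρ + t • σ).map ψ = s • (μ ∗ ρ.map ψ) + t • (μ ∗ σ.map ψ) := by
  simp only [← Measure.coe_nnreal_smul]
  rw [Measure.map_add _ _ (measurable_linearEquiv _), Measure.map_smul, Measure.map_smul,
    Measure.conv_add, Measure.conv_smul_right, Measure.conv_smul_right]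

lemma twist_smul_add_smul [∀ k, IsProbabilityMeasure (lam k)] [IsProbabilityMeasure ρ]
    [IsProbabilityMeasure σ] (s t : ℝ≥0) :
    twist φ lam (s • ρ + t • σ) = s • twist φ lam ρ + t • twist φ lam σ := by
  funext k
  simp only [twist, Pi.add_apply, Pi.smul_apply]
  rw [conv_map_smul_add_smul]

/-- If there is a solution, then there is a fundamental solution from which the factor of every
other solution is uniquely determined. -/
theorem IsSolution.exists_fundamental (hmu : ∀ k, IsProbabilityMeasure (mu k))
    (h : IsSolution mu φ lam) : ∃ L, IsFundamentalSolution mu φ L ∧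
      ∀ ρ₁ ρ₂ : Measure (EuclideanSpace ℝ (Fin d)), IsProbabilityMeasure ρ₁ →
        IsProbabilityMeasure ρ₂ → _root_.twist φ L ρ₁ = _root_.twist φ L ρ₂ → ρ₁ = ρ₂ := by
  have untwist : ∀ ν, IsSolution mu φ ν → ∀ k, (ν k).map ⇑(φ ^ (-k)) =
      (mu k).map ⇑(φ ^ (-k)) ∗ (ν (k - 1)).map ⇑(φ ^ (-(k - 1))) := by
    intro ν hν k
    have := hν.1
    conv_lhs => rw [hν.2 k]
    rw [map_conv_linearEquiv, map_zpow_map]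
    congr 5
    ring
  have := h.1
  obtain ⟨L, hLp, hLs, hLf, hL0⟩ := exists_fundamental_of_isSolution
    (fun k => (mu k).map ⇑(φ ^ (-k))) (fun k => (lam k).map ⇑(φ ^ (-k))) (untwist lam h)
  refine ⟨fun k => (L k).map ⇑(φ ^ k), ⟨⟨fun k => inferInstance, fun k => ?_⟩, ?_⟩, ?_⟩
  · beta_reduce
    conv_lhs => rw [hLs k]
    rw [map_conv_linearEquiv, map_zpow_map_zpow, map_map_zpow, add_neg_cancel, map_zpow_zero,
      add_sub_cancel]
  · intro ν hν
    have := hν.1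
    obtain ⟨ρ, hρ, hνρ⟩ := hLf _ (fun k => inferInstance) (untwist ν hν)
    refine ⟨ρ, hρ, funext fun k => ?_⟩
    simp only [_root_.twist]
    rw [← map_conv_linearEquiv, ← hνρ k, map_zpow_map_zpow, add_neg_cancel, map_zpow_zero]
  · intro ρ₁ ρ₂ _ _ he
    refine Measure.ext_of_charFun (funext fun t => ?_)
    obtain ⟨k, hk⟩ := hL0 t
    have hek := congrArg (Measure.map ⇑(φ ^ (-k))) (congrFun he k)
    simp only [_root_.twist] at hek
    rw [← map_conv_linearEquiv, ← map_conv_linearEquiv, map_zpow_map_zpow, map_zpow_map_zpow,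
      neg_add_cancel, map_zpow_zero, map_zpow_zero] at hek
    have := congrArg (fun m => charFun m t) hek
    simp only [charFun_conv] at this
    exact mul_left_cancel₀ hk this

lemma convex_solutionSet (hmu : ∀ k, IsProbabilityMeasure (mu k)) :
    Convex ℝ≥0 (solutionSet mu φ) := by
  intro x hx y hy s t _ _ hst
  have hxp := hx.1
  have hyp := hy.1
  refine ⟨fun k => isProbabilityMeasure_smul_add_smul hst, fun k => ?_⟩
  simp only [Pi.add_apply, Pi.smul_apply]
  rw [conv_map_smul_add_smul, ← hx.2 k, ← hy.2 k]

variable {L : ℤ → Measure (EuclideanSpace ℝ (Fin d))}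

lemma mem_extremalSolutions_iff (hmu : ∀ k, IsProbabilityMeasure (mu k))
    (hL : IsFundamentalSolution mu φ L)
    (hinj : ∀ ρ₁ ρ₂ : Measure (EuclideanSpace ℝ (Fin d)), IsProbabilityMeasure ρ₁ →
        IsProbabilityMeasure ρ₂ → twist φ L ρ₁ = twist φ L ρ₂ → ρ₁ = ρ₂) :
    lam ∈ extremalSolutions mu φ ↔ ∃ v, lam = twist φ L (Measure.dirac v) := by
  have := hL.1.1
  constructor
  · rintro ⟨hlam, hext⟩
    obtain ⟨ρ, hρ, rfl⟩ := hL.2 lam hlam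
    by_contra! hc
    obtain ⟨ρ₁, ρ₂, s, t, h₁, h₂, hs, ht, hst, hadd, hne⟩ :=
      exists_convex_combination_of_not_dirac (ρ := ρ) fun v hv => hc v (by rw [hv])
    refine hne (hinj _ _ h₁ hρ (hext hL.1.twist (hL.1.twist (ρ := ρ₂))
      ⟨s, t, hs, ht, hst, ?_⟩))
    rw [← twist_smul_add_smul, hadd]
  · rintro ⟨v, rfl⟩
    refine ⟨hL.1.twist, fun x hx y hy hxy => ?_⟩
    obtain ⟨s, t, hs, ht, hst, hadd⟩ := hxy
    obtain ⟨ρ₁, h₁, rfl⟩ := hL.2 x hx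
    obtain ⟨ρ₂, h₂, rfl⟩ := hL.2 y hy
    rw [← twist_smul_add_smul] at hadd
    rw [eq_dirac_of_smul_add_smul_eq_dirac hs
      (hinj _ _ (isProbabilityMeasure_smul_add_smul hst) inferInstance hadd)]

/-- If `L ∗ ρ` is fundamental, it recovers `L` through some `σ`, and injectivity gives `ρ ∗ σ =
δ_0`. Conversely a shift by `v` is undone by `-v`. -/
lemma isFundamentalSolution_iff (hmu : ∀ k, IsProbabilityMeasure (mu k))
    (hL : IsFundamentalSolution mu φ L)
    (hinj : ∀ ρ₁ ρ₂ : Measure (EuclideanSpace ℝ (Fin d)), IsProbabilityMeasure ρ₁ →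
        IsProbabilityMeasure ρ₂ → twist φ L ρ₁ = twist φ L ρ₂ → ρ₁ = ρ₂) :
    IsFundamentalSolution mu φ lam ↔ ∃ v, lam = twist φ L (Measure.dirac v) := by
  have := hL.1.1
  constructor
  · intro hlam
    obtain ⟨ρ, hρ, rfl⟩ := hL.2 lam hlam.1
    obtain ⟨σ, hσ, he⟩ := hlam.2 L hL.1
    rw [twist_twist] at he
    obtain ⟨v, rfl⟩ := exists_eq_dirac_of_conv_eq_dirac_zero
      (hinj (ρ ∗ σ) (Measure.dirac 0) inferInstance inferInstance
        (by rw [← he, twist_dirac_zero]))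
    exact ⟨v, rfl⟩
  · rintro ⟨v, rfl⟩
    refine ⟨hL.1.twist, fun ν hν => ?_⟩
    obtain ⟨ρ, hρ, rfl⟩ := hL.2 ν hν
    refine ⟨Measure.dirac (-v) ∗ ρ, inferInstance, ?_⟩
    rw [twist_twist, ← Measure.conv_assoc, Measure.dirac_conv_dirac, add_neg_cancel,
      Measure.dirac_zero_conv]

end Twist

/-! ### The main theorem -/

theorem mainTheorem2 (d : ℕ) (mu : ℤ → Measure (EuclideanSpace ℝ (Fin d)))
    (hmu : ∀ k : ℤ, IsProbabilityMeasure (mu k))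
    (φ : EuclideanSpace ℝ (Fin d) ≃ₗ[ℝ] EuclideanSpace ℝ (Fin d)) :
    Convex ℝ≥0 (solutionSet mu φ) ∧
    (∀ lam : ℤ → Measure (EuclideanSpace ℝ (Fin d)),
      IsFundamentalSolution mu φ lam ↔ lam ∈ extremalSolutions mu φ) ∧
    (extremalSolutions mu φ = ∅ ∨
      ((extremalSolutions mu φ).Nonempty ∧ ∀ lam ∈ extremalSolutions mu φ,
        Set.BijOn (fun v : EuclideanSpace ℝ (Fin d) => twist φ lam (Measure.dirac v))
          Set.univ (extremalSolutions mu φ))) := by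
  refine ⟨convex_solutionSet hmu, ?_⟩
  by_cases hex : ∃ lam, IsSolution mu φ lam
  · obtain ⟨lam₀, h₀⟩ := hex
    obtain ⟨L, hL, hinj⟩ := h₀.exists_fundamental hmu
    have := hL.1.1
    have hext := fun lam => mem_extremalSolutions_iff (lam := lam) hmu hL hinj
    refine ⟨fun lam => (isFundamentalSolution_iff hmu hL hinj).trans (hext lam).symm,
      Or.inr ⟨⟨_, (hext _).2 ⟨0, rfl⟩⟩, fun lam hlam => ?_⟩⟩
    obtain ⟨w, rfl⟩ := (hext lam).1 hlam
    have htw : ∀ v, twist φ (twist φ L (Measure.dirac w)) (Measure.dirac v) =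
        twist φ L (Measure.dirac (w + v)) := fun v => by
      rw [twist_twist, Measure.dirac_conv_dirac]
    simp only [htw]
    refine ⟨fun v _ => (hext _).2 ⟨_, rfl⟩, fun v _ v' _ he => ?_, fun x hx => ?_⟩
    · have := hinj _ _ inferInstance inferInstance he
      exact add_left_cancel (dirac_eq_dirac_iff.1 this)
    · obtain ⟨v, rfl⟩ := (hext x).1 hx
      exact ⟨v - w, trivial, by simp⟩
  · push Not at hex
    exact ⟨fun lam => ⟨fun h => absurd h.1 (hex lam), fun h => absurd h.1 (hex lam)⟩,
      Or.inl (Set.eq_empty_of_forall_notMem fun lam h => hex lam h.1)⟩
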